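/- Let $(E,\mathcal E,m)$ and $(E_\partial,\mathcal E_\partial,m_\partial)$ be $\sigma$-finite measure spaces, $L^1=L^1(E,m)$, $L^1_\partial=L^1(E_\partial,m_\partial)$ (real spaces). Let $\mathcal D\subseteq L^1$ be a linear subspace, $A\colon\mathcal D\to L^1$ a linear operator, and $B\colon\mathcal D\to L^1$, $\Psi_0,\Psi\colon\mathcal D\to L^1_\partial$ positive linear operators (nonnegative elements are mapped to nonnegative elements). A substochastic semigroup on $L^1$ is a $C_0$-semigroup of positive contractions on $L^1$. Assume: (i) the restriction $A_0$ of $A$ to $\mathcal D(A_0)=\{f\in\mathcal D:\Psi_0f=0\}$ is the generator of a substochastic semigroup on $L^1$; (ii) if $\Psi_0\not\equiv0$, then for each $\lambda>0$ there is a positive linear operator $\Psi(\lambda)\colon L^1_\partial\to\operatorname{Ker}(\lambda-A)=\{f\in\mathcal D:\lambda f-Af=0\}$ with $\Psi_0\Psi(\lambda)f_\partial=f_\partial$ for all $f_\partial\in L^1_\partial$; if $\Psi_0\equiv0$, put $\Psi(\lambda)=0$; (iii) for each nonnegative $f\in\mathcal D$, $$\int_E(Af+Bf)\,dm+\int_{E_\partial}(\Psi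 f-\Psi_0f)\,dm_\partial\le0.$$ Write $R(\lambda,G)=(\lambda-G)^{-1}$ for the resolvent of an operator $G$, and let $\{P(t)\}_{t\ge0}$ be the perturbed semigroup, i.e. the (unique) substochastic semigroup on $L^1$ whose generator $G$ has, for every $\lambda>0$, the resolvent $$R(\lambda,G)f=\lim_{N\to\infty}\sum_{k=0}^N\bigl(R(\lambda,A_0)B+\Psi(\lambda)\Psi\bigr)^kR(\lambda,A_0)f,\qquad f\in L^1.$$ Let $K$ be the operator on $L^1\times L^1_\partial$ (with norm $\|(f,f_\partial)\|=\|f\|+\|f_\partial\|$) given by $$K(f,f_\partial)=\lim_{\lambda\downarrow0}\bigl(Bu_\lambda,\Psi u_\lambda\bigr),\qquad u_\lambda=R(\lambda,A_0)f+\Psi(\lambda)f_\partial .$$ Let $(f,f_\partial)$ be an invariant density for $K$, i.e. $f\ge0$, $f_\partial\ge0$, $\|(f,f_\partial)\|=1$ and $K(f,f_\partial)=(f,f_\partial)$, and let $$\overline f=\sup_{\lambda>0}\bigl(R(\lambda,A_0)f+\Psi(\lambda)f_\partial\bigr).$$ If $\overline f\in L^1$, then $\overline f/\|\overline f\|$ is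 an invariant density for $\{P(t)\}_{t\ge0}$: it is nonnegative, has norm $1$, and $P(t)\bigl(\overline f/\|\overline f\|\bigr)=\overline f/\|\overline f\|$ for every $t>0$. -/

import Mathlib

open MeasureTheory Filter Topology

noncomputable section

namespace BoundaryPerturbation

/-! ## Unbounded operators: resolvent set and resolvent -/

section Operators

variable {X : Type*} [NormedAddCommGroup X] [NormedSpace ℝ X]

/-- The operator `l - G`, defined on the domain of `G`. -/
def shift (G : X →ₗ.[ℝ] X) (l : ℝ) : G.domain →ₗ[ℝ] X :=
  l • G.domain.subtype - G.toFun

/-- `l` belongs to the resolvent set of `G` if `l - G` is one-to-one and onto and its inverse is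
a bounded (i.e. continuous) operator on `X`. -/
def resolventSet (G : X →ₗ.[ℝ] X) : Set ℝ :=
  {l | ∃ h : Function.Bijective (shift G l),
    Continuous fun g : X => (((LinearEquiv.ofBijective (shift G l) h).symm g : G.domain) : X)}

open Classical in
/-- The resolvent `R(l, G) = (l - G)⁻¹`, with values in the domain of `G`
(and, by convention, `0` if `l` is not in the resolvent set). -/
def resolventOp (G : X →ₗ.[ℝ] X) (l : ℝ) : X →ₗ[ℝ] G.domain :=
  if h : l ∈ resolventSet G then
    ((LinearEquiv.ofBijective (shift G l) h.choose).symm : X →ₗ[ℝ] G.domain)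
  else 0

/-- `f` is in the domain of the infinitesimal generator of `P`, and the generator maps `f` to `g`:
`(P(t) f - f) / t → g` as `t ↓ 0`. -/
def GeneratorLim (P : ℝ → X →L[ℝ] X) (f g : X) : Prop :=
  Tendsto (fun t : ℝ => t⁻¹ • (P t f - f)) (𝓝[>] 0) (𝓝 g)

theorem GeneratorLim.add {P : ℝ → X →L[ℝ] X} {f₁ f₂ g₁ g₂ : X}
    (h₁ : GeneratorLim P f₁ g₁) (h₂ : GeneratorLim P f₂ g₂) :
    GeneratorLim P (f₁ + f₂) (g₁ + g₂) := by
  refine (Tendsto.add h₁ h₂).congr fun t => ?_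
  rw [map_add, ← smul_add]
  congr 1
  abel

theorem GeneratorLim.smul {P : ℝ → X →L[ℝ] X} {f g : X} (c : ℝ) (h : GeneratorLim P f g) :
    GeneratorLim P (c • f) (c • g) := by
  refine (Tendsto.const_smul h c).congr fun t => ?_
  rw [map_smul, ← smul_sub, smul_comm]

/-- The infinitesimal generator of `P`, with its full domain: all `f` for which the limit of
`(P(t) f - f) / t` as `t ↓ 0` exists. -/
def generator (P : ℝ → X →L[ℝ] X) : X →ₗ.[ℝ] X where
  domain :=
    { carrier := {f | ∃ g, GeneratorLim P f g}
      add_mem' := fun ⟨_, h₁⟩ ⟨_, h₂⟩ => ⟨_, h₁.add h₂⟩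
      zero_mem' := ⟨0, by simp [GeneratorLim]⟩
      smul_mem' := fun c _ ⟨_, h⟩ => ⟨_, h.smul c⟩ }
  toFun :=
    { toFun := fun f => f.2.choose
      map_add' := fun f₁ f₂ => tendsto_nhds_unique (f₁ + f₂).2.choose_spec
        (f₁.2.choose_spec.add f₂.2.choose_spec)
      map_smul' := fun c f => tendsto_nhds_unique (c • f).2.choose_spec
        (f.2.choose_spec.smul c) }

end Operators

/-! ## Substochastic semigroups on `L¹` -/

section Semigroups

variable {E : Type*} [MeasurableSpace E] {m : Measure E}

/-- A substochastic operator on `L¹`: a positive contraction. -/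
structure IsSubstochastic (P : Lp ℝ 1 m →L[ℝ] Lp ℝ 1 m) : Prop where
  nonneg : ∀ f, 0 ≤ f → 0 ≤ P f
  norm_le : ∀ f, 0 ≤ f → ‖P f‖ ≤ ‖f‖

/-- A substochastic semigroup `{P(t)}_{t ≥ 0}` on `L¹`: a `C₀`-semigroup of substochastic
operators. The values of `P` at negative times play no role. -/
structure IsSubstochasticSemigroup (P : ℝ → Lp ℝ 1 m →L[ℝ] Lp ℝ 1 m) : Prop where
  substochastic : ∀ t, 0 ≤ t → IsSubstochastic (P t)
  zero : P 0 = ContinuousLinearMap.id ℝ (Lp ℝ 1 m)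
  add : ∀ s t, 0 ≤ s → 0 ≤ t → P (t + s) = (P t).comp (P s)
  continuousOn : ∀ f, ContinuousOn (fun t => P t f) (Set.Ici 0)

/-- An invariant density of a semigroup: a nonnegative element of norm `1` that is fixed by
`P(t)` for each `t > 0`. -/
structure IsInvariantDensity (P : ℝ → Lp ℝ 1 m →L[ℝ] Lp ℝ 1 m) (f : Lp ℝ 1 m) : Prop where
  nonneg : 0 ≤ f
  norm_eq_one : ‖f‖ = 1
  invariant : ∀ t, 0 < t → P t f = f

end Semigroups

/-! ## Inner and boundary perturbations -/

section Perturbation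

variable {E F : Type*} [MeasurableSpace E] [MeasurableSpace F] {m : Measure E} {n : Measure F}
  {D : Submodule ℝ (Lp ℝ 1 m)}

/-- Positivity of an operator defined on a subspace `D` of `L¹`. -/
def PositiveOn (T : D →ₗ[ℝ] Lp ℝ 1 n) : Prop :=
  ∀ f : D, 0 ≤ (f : Lp ℝ 1 m) → 0 ≤ T f

/-- The operator `A₀`: the restriction of `A` to `{f ∈ D : Ψ₀ f = 0}`. -/
def kerRestrict (A : D →ₗ[ℝ] Lp ℝ 1 m) (Ψ₀ : D →ₗ[ℝ] Lp ℝ 1 n) :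
    Lp ℝ 1 m →ₗ.[ℝ] Lp ℝ 1 m :=
  (LinearPMap.mk D A).domRestrict ((LinearMap.ker Ψ₀).map D.subtype)

/-- `R(l, A₀)`, regarded as an operator from `L¹` to `D`. -/
def res₀ (A : D →ₗ[ℝ] Lp ℝ 1 m) (Ψ₀ : D →ₗ[ℝ] Lp ℝ 1 n) (l : ℝ) : Lp ℝ 1 m →ₗ[ℝ] D :=
  (Submodule.inclusion (show (kerRestrict A Ψ₀).domain ≤ D from fun _ h => h.2)).comp
    (resolventOp (kerRestrict A Ψ₀) l)

/-- The family `Ψ(l)`, `l > 0`: if `Ψ₀` is not identically zero, `Ψ(l)` is a positive right inverse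
of the restriction of `Ψ₀` to the null space of `l - A`; if `Ψ₀` is identically zero, no right
inverse is required and, by convention, `Ψ(l)` is the zero operator. -/
structure IsRightInverseFamily (A : D →ₗ[ℝ] Lp ℝ 1 m) (Ψ₀ : D →ₗ[ℝ] Lp ℝ 1 n)
    (Ψl : ℝ → Lp ℝ 1 n →ₗ[ℝ] D) : Prop where
  mem_ker : Ψ₀ ≠ 0 → ∀ l, 0 < l → ∀ g, l • (Ψl l g : Lp ℝ 1 m) - A (Ψl l g) = 0
  right_inv : Ψ₀ ≠ 0 → ∀ l, 0 < l → ∀ g, Ψ₀ (Ψl l g) = g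
  nonneg : Ψ₀ ≠ 0 → ∀ l, 0 < l → ∀ g, 0 ≤ g → 0 ≤ (Ψl l g : Lp ℝ 1 m)
  eq_zero : Ψ₀ = 0 → ∀ l, 0 < l → Ψl l = 0

/-- `R(l, A₀) f + Ψ(l) f_∂`, an element of `D`. -/
def res (A : D →ₗ[ℝ] Lp ℝ 1 m) (Ψ₀ : D →ₗ[ℝ] Lp ℝ 1 n) (Ψl : ℝ → Lp ℝ 1 n →ₗ[ℝ] D)
    (l : ℝ) (f : Lp ℝ 1 m) (g : Lp ℝ 1 n) : D :=
  res₀ A Ψ₀ l f + Ψl l g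

/-- `(f, g)` is an invariant density of the operator `K` on `L¹ × L¹_∂`, where
`K (f, g) = lim_{l ↓ 0} (B u_l, Ψ u_l)` with `u_l = R(l, A₀) f + Ψ(l) g`: it is nonnegative, has norm
`‖f‖ + ‖g‖ = 1`, and the limit defining `K (f, g)` in `L¹ × L¹_∂` equals `(f, g)`. -/
structure IsInvariantDensityK (A B : D →ₗ[ℝ] Lp ℝ 1 m) (Ψ₀ Ψ : D →ₗ[ℝ] Lp ℝ 1 n)
    (Ψl : ℝ → Lp ℝ 1 n →ₗ[ℝ] D) (f : Lp ℝ 1 m) (g : Lp ℝ 1 n) : Prop where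
  nonneg_fst : 0 ≤ f
  nonneg_snd : 0 ≤ g
  norm_eq_one : ‖f‖ + ‖g‖ = 1
  invariant : Tendsto (fun l : ℝ => (B (res A Ψ₀ Ψl l f g), Ψ (res A Ψ₀ Ψl l f g)))
    (𝓝[>] 0) (𝓝 (f, g))

/-- The operator `R(l, A₀) B + Ψ(l) Ψ` on `D`. -/
def stepOp (A B : D →ₗ[ℝ] Lp ℝ 1 m) (Ψ₀ Ψ : D →ₗ[ℝ] Lp ℝ 1 n)
    (Ψl : ℝ → Lp ℝ 1 n →ₗ[ℝ] D) (l : ℝ) : Module.End ℝ D :=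
  (res₀ A Ψ₀ l).comp B + (Ψl l).comp Ψ

/-- `P` is the perturbed semigroup: the substochastic semigroup on `L¹` whose generator `G` has
resolvent `R(l, G) f = lim_{N → ∞} ∑_{k=0}^N (R(l, A₀) B + Ψ(l) Ψ)^k R(l, A₀) f` for `l > 0`.
The resolvent determines `G`, and hence `P(t)`, `t ≥ 0`, uniquely. -/
structure IsPerturbedSemigroup (A B : D →ₗ[ℝ] Lp ℝ 1 m) (Ψ₀ Ψ : D →ₗ[ℝ] Lp ℝ 1 n)
    (Ψl : ℝ → Lp ℝ 1 n →ₗ[ℝ] D) (P : ℝ → Lp ℝ 1 m →L[ℝ] Lp ℝ 1 m) : Prop where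
  semigroup : IsSubstochasticSemigroup P
  resolvent : ∀ l, 0 < l → ∀ f : Lp ℝ 1 m,
    Tendsto (fun N : ℕ => ∑ k ∈ Finset.range (N + 1),
        (((stepOp A B Ψ₀ Ψ Ψl l ^ k) (res₀ A Ψ₀ l f) : D) : Lp ℝ 1 m))
      atTop (𝓝 (resolventOp (generator P) l f : Lp ℝ 1 m))

end Perturbation

end BoundaryPerturbation

end

open BoundaryPerturbation

/-! ### The order structure of real `L¹` -/

section L1Order

variable {E : Type*} [MeasurableSpace E] {m : Measure E}

/-! Write u_l = R(l, A₀) f + Ψ(l) f_∂ and T_l = R(l, A₀) B + Ψ(l) Ψ. Formally, letting l ↓ 0 in (l -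
A) u_l = f and Ψ₀ u_l = f_∂ and using K-invariance gives (A + B) f̄ = 0 and Ψ₀ f̄ = Ψ f̄. But f̄ is
not known to lie in `D`, so the argument goes through the resolvent of the generator G of P.

For fixed l, the resolvent identity `sub_smul_res₀_res` reads (l - l') R(l, A₀) u_{l'} = u_{l'} -
u_l, and u_l is T_l u_{l'} plus a term produced by the defect (f - B u_{l'}, f_∂ - Ψ u_{l'}), which
is nonnegative by monotonicity. Hence the series for R(l, G) u_{l'} telescopes. The mass balance
`norm_res_add_le` makes its remainder vanish and bounds the defect terms
(`norm_sub_smul_resolventOp_le`).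

As l' ↓ 0, u_{l'} → f̄ by monotone convergence and the defect tends to 0 by K-invariance. So l R(l,
G) f̄ = f̄, that is, G f̄ = 0, and P fixes f̄. -/

instance Lp.instIsOrderedModuleReal : IsOrderedModule ℝ (Lp ℝ 1 m) :=
  .of_smul_nonneg fun a ha f hf => by
    rw [← Lp.coeFn_nonneg] at hf ⊢
    filter_upwards [hf, Lp.coeFn_smul a f] with x hx hx'
    rw [hx']
    exact mul_nonneg ha hx

theorem L1.norm_eq_integral_of_nonneg {f : Lp ℝ 1 m} (hf : 0 ≤ f) : ‖f‖ = L1.integral f := by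
  rw [L1.norm_eq_integral_norm, L1.integral_eq_integral]
  rw [← Lp.coeFn_nonneg] at hf
  refine integral_congr_ae ?_
  filter_upwards [hf] with x hx
  exact Real.norm_of_nonneg hx

theorem L1.integral_nonneg_of_nonneg {f : Lp ℝ 1 m} (hf : 0 ≤ f) : 0 ≤ L1.integral f := by
  rw [← L1.norm_eq_integral_of_nonneg hf]
  exact norm_nonneg f

theorem L1.norm_posPart_add_norm_negPart (f : Lp ℝ 1 m) : ‖f⁺‖ + ‖f⁻‖ = ‖f‖ := by
  rw [L1.norm_eq_integral_of_nonneg (posPart_nonneg f),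
    L1.norm_eq_integral_of_nonneg (negPart_nonneg f), ← norm_abs_eq_norm f,
    L1.norm_eq_integral_of_nonneg (abs_nonneg f), ← L1.integral_add, posPart_add_negPart]

/-- Monotone convergence in `L¹`: a nondecreasing sequence bounded from above converges in norm. -/
theorem L1.exists_tendsto_of_monotone {u : ℕ → Lp ℝ 1 m} (hu : Monotone u) {w : Lp ℝ 1 m}
    (hw : ∀ k, u k ≤ w) : ∃ v, Tendsto u atTop (𝓝 v) := by
  have hmono : Monotone fun k => L1.integral (u k) := fun i j hij => by
    have := L1.integral_nonneg_of_nonneg (sub_nonneg.2 (hu hij))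
    rw [L1.integral_sub] at this
    exact sub_nonneg.1 this
  have hbdd : BddAbove (Set.range fun k => L1.integral (u k)) := by
    refine ⟨L1.integral w, ?_⟩
    rintro _ ⟨k, rfl⟩
    have := L1.integral_nonneg_of_nonneg (sub_nonneg.2 (hw k))
    rw [L1.integral_sub] at this
    exact sub_nonneg.1 this
  have hc : CauchySeq fun k => L1.integral (u k) :=
    (tendsto_atTop_ciSup hmono hbdd).cauchySeq
  refine cauchySeq_tendsto_of_complete (Metric.cauchySeq_iff.2 fun ε hε => ?_)
  obtain ⟨N, hN⟩ := Metric.cauchySeq_iff.1 hc ε hε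
  -- The norm is the integral on the positive cone, so along a monotone sequence distances in `L¹`
  -- are distances between real integrals.
  have key : ∀ i j, i ≤ j → dist (u i) (u j) = dist (L1.integral (u i)) (L1.integral (u j)) := by
    intro i j hij
    rw [dist_comm, dist_comm (L1.integral (u i)), dist_eq_norm, Real.dist_eq,
      L1.norm_eq_integral_of_nonneg (sub_nonneg.2 (hu hij)), L1.integral_sub,
      abs_of_nonneg (sub_nonneg.2 (hmono hij))]
  refine ⟨N, fun i hi j hj => ?_⟩
  rcases le_total i j with h | h
  · rw [key i j h]; exact hN i hi j hj
  · rw [dist_comm, key j i h]; exact hN j hj i hi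

end L1Order

/-! ### Resolvents -/

section Resolvent

variable {X : Type*} [NormedAddCommGroup X] [NormedSpace ℝ X] {G : X →ₗ.[ℝ] X} {l : ℝ}

theorem resolventOp_shift (hl : l ∈ resolventSet G) (x : G.domain) :
    resolventOp G l (shift G l x) = x := by
  rw [resolventOp, dif_pos hl]
  exact (LinearEquiv.ofBijective (shift G l) hl.choose).symm_apply_apply x

theorem shift_resolventOp (hl : l ∈ resolventSet G) (g : X) :
    shift G l (resolventOp G l g) = g := by
  rw [resolventOp, dif_pos hl]
  exact (LinearEquiv.ofBijective (shift G l) hl.choose).apply_symm_apply g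

theorem continuous_resolventOp (hl : l ∈ resolventSet G) :
    Continuous fun g : X => (resolventOp G l g : X) := by
  rw [resolventOp, dif_pos hl]
  exact hl.choose_spec

end Resolvent

/-! ### Generators of substochastic semigroups -/

section SubstochasticSemigroup

variable {E : Type*} [MeasurableSpace E] {m : Measure E} {P : ℝ → Lp ℝ 1 m →L[ℝ] Lp ℝ 1 m}

/-- Contractivity is assumed only on the positive cone; it extends because the `L¹` norm is additive
over positive and negative parts. -/
theorem BoundaryPerturbation.IsSubstochastic.norm_apply_le {T : Lp ℝ 1 m →L[ℝ] Lp ℝ 1 m}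
    (hT : IsSubstochastic T) (f : Lp ℝ 1 m) : ‖T f‖ ≤ ‖f‖ := by
  calc ‖T f‖ = ‖T f⁺ - T f⁻‖ := by rw [← map_sub, posPart_sub_negPart]
    _ ≤ ‖T f⁺‖ + ‖T f⁻‖ := norm_sub_le _ _
    _ ≤ ‖f⁺‖ + ‖f⁻‖ :=
        add_le_add (hT.norm_le _ (posPart_nonneg f)) (hT.norm_le _ (negPart_nonneg f))
    _ = ‖f‖ := L1.norm_posPart_add_norm_negPart f

/-- The discounted orbit `e^{-lt} P(t) f`, frozen at `P(0) f` for negative times. -/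
noncomputable def discountedOrbit (P : ℝ → Lp ℝ 1 m →L[ℝ] Lp ℝ 1 m) (l : ℝ) (f : Lp ℝ 1 m) (t : ℝ) :
    Lp ℝ 1 m :=
  Real.exp (-l * t) • P (max t 0) f

/-- The Laplace transform of an orbit. -/
noncomputable def laplaceOrbit (P : ℝ → Lp ℝ 1 m →L[ℝ] Lp ℝ 1 m) (l : ℝ) (f : Lp ℝ 1 m) :
    Lp ℝ 1 m :=
  ∫ t in Set.Ioi 0, discountedOrbit P l f t

namespace BoundaryPerturbation.IsSubstochasticSemigroup

theorem continuous_discountedOrbit (hP : IsSubstochasticSemigroup P) (l : ℝ) (f : Lp ℝ 1 m) :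
    Continuous (discountedOrbit P l f) := by
  have h : Continuous fun t : ℝ => P (max t 0) f :=
    (hP.continuousOn f).comp_continuous (continuous_id.max continuous_const)
      fun t => le_max_right t 0
  exact (by fun_prop : Continuous fun t : ℝ => Real.exp (-l * t)).smul h

theorem norm_discountedOrbit_le (hP : IsSubstochasticSemigroup P) (l : ℝ) (f : Lp ℝ 1 m)
    (t : ℝ) : ‖discountedOrbit P l f t‖ ≤ Real.exp (-l * t) * ‖f‖ := by
  rw [discountedOrbit, norm_smul, Real.norm_of_nonneg (Real.exp_pos _).le]
  gcongr
  exact (hP.substochastic _ (le_max_right t 0)).norm_apply_le f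

theorem integrableOn_discountedOrbit (hP : IsSubstochasticSemigroup P) {l : ℝ} (hl : 0 < l)
    (f : Lp ℝ 1 m) : IntegrableOn (discountedOrbit P l f) (Set.Ioi 0) :=
  ((exp_neg_integrableOn_Ioi 0 hl).mul_const ‖f‖).mono'
    (hP.continuous_discountedOrbit l f).aestronglyMeasurable
    (Eventually.of_forall (hP.norm_discountedOrbit_le l f))

theorem laplaceOrbit_nonneg (hP : IsSubstochasticSemigroup P) (l : ℝ) {f : Lp ℝ 1 m}
    (hf : 0 ≤ f) : 0 ≤ laplaceOrbit P l f :=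
  integral_nonneg fun t => smul_nonneg (Real.exp_pos _).le
    ((hP.substochastic _ (le_max_right t 0)).nonneg f hf)

theorem norm_laplaceOrbit_le (hP : IsSubstochasticSemigroup P) {l : ℝ} (hl : 0 < l)
    (f : Lp ℝ 1 m) :
    ‖laplaceOrbit P l f‖ ≤ (∫ t in Set.Ioi (0 : ℝ), Real.exp (-l * t)) * ‖f‖ := by
  rw [← integral_mul_const]
  exact norm_integral_le_of_norm_le ((exp_neg_integrableOn_Ioi 0 hl).mul_const ‖f‖)
    (Eventually.of_forall (hP.norm_discountedOrbit_le l f))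

/-- Semigroup law and the substitution t ↦ t + h in the Laplace integral; differentiating the result
at h = 0 gives the generator. -/
theorem map_laplaceOrbit (hP : IsSubstochasticSemigroup P) {l : ℝ} (hl : 0 < l)
    (f : Lp ℝ 1 m) {h : ℝ} (hh : 0 ≤ h) :
    P h (laplaceOrbit P l f) =
      Real.exp (l * h) • (laplaceOrbit P l f - ∫ t in (0 : ℝ)..h, discountedOrbit P l f t) := by
  have hint := hP.integrableOn_discountedOrbit hl f
  have hshift : ∀ t ∈ Set.Ioi (0 : ℝ), P h (discountedOrbit P l f t) =
      Real.exp (l * h) • discountedOrbit P l f (t + h) := by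
    intro t ht
    have ht : 0 ≤ t := le_of_lt ht
    rw [discountedOrbit, discountedOrbit, map_smul, smul_smul, ← Real.exp_add,
      max_eq_left ht, max_eq_left (add_nonneg ht hh), add_comm t h, hP.add t h ht hh]
    rw [show l * h + -l * (h + t) = -l * t by ring]
    rfl
  have hpre : (fun t : ℝ => t + h) ⁻¹' Set.Ioi h = Set.Ioi 0 := by
    ext t
    simp
  rw [laplaceOrbit, ← ContinuousLinearMap.integral_comp_comm _ hint,
    setIntegral_congr_fun measurableSet_Ioi hshift, integral_smul]
  congr 1
  rw [← intervalIntegral.integral_Ioi_sub_Ioi hint hh, sub_sub_cancel, ← hpre]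
  exact (measurePreserving_add_right volume h).setIntegral_preimage_emb
    (measurableEmbedding_addRight h) (discountedOrbit P l f) (Set.Ioi h)

theorem generatorLim_laplaceOrbit (hP : IsSubstochasticSemigroup P) {l : ℝ} (hl : 0 < l)
    (f : Lp ℝ 1 m) :
    GeneratorLim P (laplaceOrbit P l f) (l • laplaceOrbit P l f - f) := by
  have hI : HasDerivAt (fun h => ∫ t in (0 : ℝ)..h, discountedOrbit P l f t) f 0 := by
    have := ((hP.continuous_discountedOrbit l f).integral_hasStrictDerivAt 0 0).hasDerivAt
    simpa [discountedOrbit, hP.zero] using this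
  have hexp : HasDerivAt (fun h : ℝ => Real.exp (l * h)) l 0 := by
    simpa using ((hasDerivAt_id (0 : ℝ)).const_mul l).exp
  have hd := hexp.smul ((hasDerivAt_const (0 : ℝ) (laplaceOrbit P l f)).sub hI)
  have hslope := hd.tendsto_slope_zero_right
  simp only [zero_add, mul_zero, Real.exp_zero, one_smul, Pi.sub_apply, Pi.smul_apply', zero_sub,
    intervalIntegral.integral_same, sub_zero] at hslope
  rw [neg_add_eq_sub] at hslope
  refine hslope.congr' ?_
  filter_upwards [self_mem_nhdsWithin] with h hh
  rw [hP.map_laplaceOrbit hl f (le_of_lt hh)]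

/-- Along the orbit of an element of the domain of the generator, `P(t) f` has the right
derivative `P(t) G f`. -/
theorem hasDerivWithinAt_orbit (hP : IsSubstochasticSemigroup P) {f g : Lp ℝ 1 m}
    (hfg : GeneratorLim P f g) {t : ℝ} (ht : 0 ≤ t) :
    HasDerivWithinAt (fun s => P s f) (P t g) (Set.Ici t) t := by
  rw [← hasDerivWithinAt_Ioi_iff_Ici, hasDerivWithinAt_iff_tendsto_slope' Set.self_notMem_Ioi]
  have h0 : Tendsto (fun s : ℝ => s - t) (𝓝[>] t) (𝓝[>] 0) := by
    refine tendsto_nhdsWithin_iff.2 ⟨?_, ?_⟩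
    · have : Tendsto (fun s : ℝ => s - t) (𝓝 t) (𝓝 (t - t)) := (continuous_sub_right t).tendsto t
      rw [sub_self] at this
      exact this.mono_left nhdsWithin_le_nhds
    · filter_upwards [self_mem_nhdsWithin] with s hs
      exact sub_pos.2 (Set.mem_Ioi.1 hs)
  refine (((P t).continuous.tendsto g).comp (hfg.comp h0)).congr' ?_
  filter_upwards [self_mem_nhdsWithin] with s hs
  have hs : t < s := hs
  have : P s f = P t (P (s - t) f) := by
    have := hP.add (s - t) t (sub_nonneg.2 hs.le) ht
    rw [add_sub_cancel] at this
    rw [this]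
    rfl
  simp [slope_def_module, this]

theorem orbit_eq_of_generatorLim_zero (hP : IsSubstochasticSemigroup P) {f : Lp ℝ 1 m}
    (hf : GeneratorLim P f 0) {t : ℝ} (ht : 0 ≤ t) : P t f = f := by
  have := constant_of_has_deriv_right_zero (f := fun s => P s f) (a := 0) (b := t)
    ((hP.continuousOn f).mono Set.Icc_subset_Ici_self)
    (fun s hs => by simpa using hP.hasDerivWithinAt_orbit hf hs.1) t ⟨ht, le_rfl⟩
  simpa [hP.zero] using this

/-- The discounted orbit has zero right derivative, so it is constant, yet contractivity forces it
to decay like e^{-lt}. -/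
theorem eq_zero_of_generatorLim_smul (hP : IsSubstochasticSemigroup P) {l : ℝ} (hl : 0 < l)
    {f : Lp ℝ 1 m} (hf : GeneratorLim P f (l • f)) : f = 0 := by
  have hconst : ∀ t : ℝ, 0 ≤ t → Real.exp (-l * t) • P t f = f := by
    intro t ht
    have hexp : ∀ s : ℝ, HasDerivAt (fun h : ℝ => Real.exp (-l * h)) (Real.exp (-l * s) * -l) s :=
      fun s => by simpa using ((hasDerivAt_id s).const_mul (-l)).exp
    have := constant_of_has_deriv_right_zero (f := fun s => Real.exp (-l * s) • P s f)
      (a := 0) (b := t)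
      ((by fun_prop : ContinuousOn (fun s : ℝ => Real.exp (-l * s)) _).smul
        ((hP.continuousOn f).mono Set.Icc_subset_Ici_self))
      (fun s hs => by
        have := (hexp s).hasDerivWithinAt.smul (hP.hasDerivWithinAt_orbit hf hs.1)
        rw [map_smul, smul_smul, ← add_smul, mul_neg, add_neg_cancel, zero_smul] at this
        exact this) t ⟨ht, le_rfl⟩
    simpa [hP.zero] using this
  have hle : ∀ t : ℝ, 0 ≤ t → ‖f‖ ≤ Real.exp (-(l * t)) * ‖f‖ := by
    intro t ht
    calc ‖f‖ = ‖Real.exp (-l * t) • P t f‖ := by rw [hconst t ht]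
      _ = Real.exp (-(l * t)) * ‖P t f‖ := by
          rw [norm_smul, Real.norm_of_nonneg (Real.exp_pos _).le, neg_mul]
      _ ≤ Real.exp (-(l * t)) * ‖f‖ := by
          gcongr
          exact (hP.substochastic t ht).norm_apply_le f
  have hlim : Tendsto (fun t : ℝ => Real.exp (-(l * t)) * ‖f‖) atTop (𝓝 (0 * ‖f‖)) :=
    (Real.tendsto_exp_neg_atTop_nhds_zero.comp (tendsto_id.const_mul_atTop hl)).mul_const _
  rw [zero_mul] at hlim
  exact norm_le_zero_iff.1
    (ge_of_tendsto hlim ((eventually_ge_atTop 0).mono hle))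

theorem generatorLim_generator (f : (generator P).domain) :
    GeneratorLim P f (generator P f) :=
  f.2.choose_spec

theorem shift_generator_eq (hP : IsSubstochasticSemigroup P) {l : ℝ} (hl : 0 < l)
    (f : Lp ℝ 1 m) :
    shift (generator P) l ⟨laplaceOrbit P l f, _, hP.generatorLim_laplaceOrbit hl f⟩ = f := by
  have h := tendsto_nhds_unique
    (generatorLim_generator ⟨laplaceOrbit P l f, _, hP.generatorLim_laplaceOrbit hl f⟩)
    (hP.generatorLim_laplaceOrbit hl f)
  change l • laplaceOrbit P l f - generator P _ = f
  rw [h]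
  abel

theorem bijective_shift_generator (hP : IsSubstochasticSemigroup P) {l : ℝ} (hl : 0 < l) :
    Function.Bijective (shift (generator P) l) := by
  refine ⟨(injective_iff_map_eq_zero _).2 fun f hf => ?_,
    fun f => ⟨_, hP.shift_generator_eq hl f⟩⟩
  have hG : l • (f : Lp ℝ 1 m) - generator P f = 0 := hf
  refine Subtype.ext (hP.eq_zero_of_generatorLim_smul hl ?_)
  rw [sub_eq_zero.1 hG]
  exact generatorLim_generator f

/-- The easy half of the Hille–Yosida theorem: positive numbers belong to the resolvent set. -/
theorem mem_resolventSet (hP : IsSubstochasticSemigroup P) {l : ℝ} (hl : 0 < l) :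
    l ∈ resolventSet (generator P) := by
  refine ⟨hP.bijective_shift_generator hl, ?_⟩
  set e := LinearEquiv.ofBijective (shift (generator P) l) (hP.bijective_shift_generator hl)
  refine AddMonoidHomClass.continuous_of_bound
    ((generator P).domain.subtype ∘ₗ (e.symm : Lp ℝ 1 m →ₗ[ℝ] (generator P).domain))
    (∫ t in Set.Ioi (0 : ℝ), Real.exp (-l * t)) fun f => ?_
  have : e.symm f = ⟨laplaceOrbit P l f, _, hP.generatorLim_laplaceOrbit hl f⟩ :=
    e.symm_apply_eq.2 (hP.shift_generator_eq hl f).symm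
  simpa [this] using hP.norm_laplaceOrbit_le hl f

theorem resolventOp_nonneg (hP : IsSubstochasticSemigroup P) {l : ℝ} (hl : 0 < l)
    {f : Lp ℝ 1 m} (hf : 0 ≤ f) : 0 ≤ (resolventOp (generator P) l f : Lp ℝ 1 m) := by
  have := resolventOp_shift (hP.mem_resolventSet hl)
    ⟨laplaceOrbit P l f, _, hP.generatorLim_laplaceOrbit hl f⟩
  rw [hP.shift_generator_eq hl] at this
  rw [this]
  exact hP.laplaceOrbit_nonneg l hf

theorem invariant_of_smul_resolventOp_eq (hP : IsSubstochasticSemigroup P) {l : ℝ} (hl : 0 < l)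
    {f : Lp ℝ 1 m} (hf : l • (resolventOp (generator P) l f : Lp ℝ 1 m) = f) {t : ℝ}
    (ht : 0 ≤ t) : P t f = f := by
  set x := resolventOp (generator P) l f
  have hx : l • (x : Lp ℝ 1 m) - generator P x = f := shift_resolventOp (hP.mem_resolventSet hl) f
  have hG : generator P x = 0 := by
    rw [hf] at hx
    exact sub_eq_self.1 hx
  have hlim := (generatorLim_generator x).smul l
  rw [hG, hf, smul_zero] at hlim
  exact hP.orbit_eq_of_generatorLim_zero hlim ht

end BoundaryPerturbation.IsSubstochasticSemigroup

end SubstochasticSemigroup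

/-! ### Inner and boundary perturbations -/

section Perturbation

variable {E F : Type*} [MeasurableSpace E] [MeasurableSpace F] {m : Measure E} {n : Measure F}
  {D : Submodule ℝ (Lp ℝ 1 m)} {A B : D →ₗ[ℝ] Lp ℝ 1 m} {Ψ₀ Ψ : D →ₗ[ℝ] Lp ℝ 1 n}
  {Ψl : ℝ → Lp ℝ 1 n →ₗ[ℝ] D} {l : ℝ}

namespace BoundaryPerturbation

theorem kerRestrict_apply (x : (kerRestrict A Ψ₀).domain) :
    kerRestrict A Ψ₀ x = A ⟨x, x.2.2⟩ :=
  LinearPMap.domRestrict_apply (f := LinearPMap.mk D A) (x := x) (y := ⟨x, x.2.2⟩) rfl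

theorem mem_resolventSet_kerRestrict
    (hi : ∃ S : ℝ → Lp ℝ 1 m →L[ℝ] Lp ℝ 1 m,
      IsSubstochasticSemigroup S ∧ generator S = kerRestrict A Ψ₀) (hl : 0 < l) :
    l ∈ resolventSet (kerRestrict A Ψ₀) := by
  obtain ⟨S, hS, hSA⟩ := hi
  exact hSA ▸ hS.mem_resolventSet hl

theorem res₀_nonneg
    (hi : ∃ S : ℝ → Lp ℝ 1 m →L[ℝ] Lp ℝ 1 m,
      IsSubstochasticSemigroup S ∧ generator S = kerRestrict A Ψ₀) (hl : 0 < l)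
    {f : Lp ℝ 1 m} (hf : 0 ≤ f) : 0 ≤ (res₀ A Ψ₀ l f : Lp ℝ 1 m) := by
  obtain ⟨S, hS, hSA⟩ := hi
  change 0 ≤ (resolventOp (kerRestrict A Ψ₀) l f : Lp ℝ 1 m)
  exact hSA ▸ hS.resolventOp_nonneg hl hf

theorem smul_res₀_sub (hl : l ∈ resolventSet (kerRestrict A Ψ₀)) (f : Lp ℝ 1 m) :
    l • (res₀ A Ψ₀ l f : Lp ℝ 1 m) - A (res₀ A Ψ₀ l f) = f := by
  have h := shift_resolventOp hl f
  change l • (resolventOp (kerRestrict A Ψ₀) l f : Lp ℝ 1 m) - kerRestrict A Ψ₀ _ = f at h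
  rw [kerRestrict_apply] at h
  exact h

theorem map_res₀_eq_zero (f : Lp ℝ 1 m) : Ψ₀ (res₀ A Ψ₀ l f) = 0 := by
  obtain ⟨y, hy, hyx⟩ := (resolventOp (kerRestrict A Ψ₀) l f).2.1
  have : res₀ A Ψ₀ l f = y := Subtype.ext hyx.symm
  rw [this]
  exact hy

theorem res₀_smul_sub (hl : l ∈ resolventSet (kerRestrict A Ψ₀)) {x : D} (hx : Ψ₀ x = 0) :
    res₀ A Ψ₀ l (l • (x : Lp ℝ 1 m) - A x) = x := by
  have hmem : (x : Lp ℝ 1 m) ∈ (kerRestrict A Ψ₀).domain := ⟨⟨x, hx, rfl⟩, x.2⟩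
  have h := resolventOp_shift hl ⟨x, hmem⟩
  have hs : shift (kerRestrict A Ψ₀) l ⟨x, hmem⟩ = l • (x : Lp ℝ 1 m) - A x := by
    change l • (x : Lp ℝ 1 m) - kerRestrict A Ψ₀ ⟨x, hmem⟩ = _
    rw [kerRestrict_apply]
  rw [hs] at h
  refine Subtype.ext ?_
  change (resolventOp (kerRestrict A Ψ₀) l _ : Lp ℝ 1 m) = x
  rw [h]

namespace IsRightInverseFamily

variable (hii : IsRightInverseFamily A Ψ₀ Ψl)
include hii

theorem smul_sub_eq_zero (hl : 0 < l) (g : Lp ℝ 1 n) :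
    l • (Ψl l g : Lp ℝ 1 m) - A (Ψl l g) = 0 := by
  by_cases h : Ψ₀ = 0
  · simp [hii.eq_zero h l hl]
  · exact hii.mem_ker h l hl g

theorem apply_nonneg (hl : 0 < l) {g : Lp ℝ 1 n} (hg : 0 ≤ g) : 0 ≤ (Ψl l g : Lp ℝ 1 m) := by
  by_cases h : Ψ₀ = 0
  · simp [hii.eq_zero h l hl]
  · exact hii.nonneg h l hl g hg

theorem map_apply_eq {l' : ℝ} (hl : 0 < l) (hl' : 0 < l') (g : Lp ℝ 1 n) :
    Ψ₀ (Ψl l g) = Ψ₀ (Ψl l' g) := by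
  by_cases h : Ψ₀ = 0
  · simp [h]
  · rw [hii.right_inv h l hl, hii.right_inv h l' hl']

/-- Equality when Ψ₀ ≠ 0; only an inequality survives when Ψ₀ = 0, and it is all the mass balance
needs. -/
theorem integral_map_apply_le (hl : 0 < l) {g : Lp ℝ 1 n} (hg : 0 ≤ g) :
    L1.integral (Ψ₀ (Ψl l g)) ≤ ‖g‖ := by
  by_cases h : Ψ₀ = 0
  · simp [h]
  · rw [hii.right_inv h l hl, L1.norm_eq_integral_of_nonneg hg]

end IsRightInverseFamily

/-! ### Resolvent identity, monotonicity and mass balance for u_l. -/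

section Res

variable (hi : ∃ S : ℝ → Lp ℝ 1 m →L[ℝ] Lp ℝ 1 m,
      IsSubstochasticSemigroup S ∧ generator S = kerRestrict A Ψ₀)
  (hii : IsRightInverseFamily A Ψ₀ Ψl)
include hi hii

theorem smul_res_sub (hl : 0 < l) (f : Lp ℝ 1 m) (g : Lp ℝ 1 n) :
    l • (res A Ψ₀ Ψl l f g : Lp ℝ 1 m) - A (res A Ψ₀ Ψl l f g) = f := by
  have h₁ := smul_res₀_sub (mem_resolventSet_kerRestrict hi hl) f
  have h₂ := hii.smul_sub_eq_zero hl g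
  rw [res, map_add, Submodule.coe_add, smul_add, add_sub_add_comm, h₁, h₂, add_zero]

theorem res_nonneg (hl : 0 < l) {f : Lp ℝ 1 m} {g : Lp ℝ 1 n} (hf : 0 ≤ f) (hg : 0 ≤ g) :
    0 ≤ (res A Ψ₀ Ψl l f g : Lp ℝ 1 m) :=
  add_nonneg (res₀_nonneg hi hl hf) (hii.apply_nonneg hl hg)

/-- The difference of the two elements is killed by Ψ₀, hence lies in the domain of A₀, and l - A
sends it to (l - l') u_{l'}. -/
theorem sub_smul_res₀_res {l' : ℝ} (hl : 0 < l) (hl' : 0 < l') (f : Lp ℝ 1 m) (g : Lp ℝ 1 n) :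
    (l - l') • res₀ A Ψ₀ l (res A Ψ₀ Ψl l' f g : Lp ℝ 1 m) =
      res A Ψ₀ Ψl l' f g - res A Ψ₀ Ψl l f g := by
  have hker : Ψ₀ (res A Ψ₀ Ψl l' f g - res A Ψ₀ Ψl l f g) = 0 := by
    rw [map_sub, res, res, map_add, map_add, map_res₀_eq_zero, map_res₀_eq_zero,
      hii.map_apply_eq hl hl', sub_self]
  rw [← res₀_smul_sub (mem_resolventSet_kerRestrict hi hl) hker, ← map_smul]
  congr 1
  have h := smul_res_sub hi hii hl f g
  have h' := smul_res_sub hi hii hl' f g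
  have hf : l' • (res A Ψ₀ Ψl l' f g : Lp ℝ 1 m) = f + A (res A Ψ₀ Ψl l' f g) :=
    sub_eq_iff_eq_add.1 h'
  rw [map_sub, Submodule.coe_sub, smul_sub, sub_sub_sub_comm, h, sub_smul, hf]
  abel

theorem res_antitone {l' : ℝ} (hl' : 0 < l') (hll' : l' ≤ l) {f : Lp ℝ 1 m} {g : Lp ℝ 1 n}
    (hf : 0 ≤ f) (hg : 0 ≤ g) :
    (res A Ψ₀ Ψl l f g : Lp ℝ 1 m) ≤ res A Ψ₀ Ψl l' f g := by
  have hl := hl'.trans_le hll'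
  have h := congrArg Subtype.val (sub_smul_res₀_res hi hii hl hl' f g)
  rw [← sub_nonneg]
  refine le_of_le_of_eq ?_ h
  exact smul_nonneg (sub_nonneg.2 hll') (res₀_nonneg hi hl (res_nonneg hi hii hl' hf hg))

/-- The mass balance for `res`. -/
theorem norm_res_add_le (hB : PositiveOn B) (hΨ : PositiveOn Ψ)
    (hiii : ∀ f : D, 0 ≤ (f : Lp ℝ 1 m) →
      (∫ x, (A f + B f) x ∂m) + (∫ y, (Ψ f - Ψ₀ f) y ∂n) ≤ 0)
    (hl : 0 < l) {f : Lp ℝ 1 m} {g : Lp ℝ 1 n} (hf : 0 ≤ f) (hg : 0 ≤ g) :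
    l * ‖(res A Ψ₀ Ψl l f g : Lp ℝ 1 m)‖ +
      (‖B (res A Ψ₀ Ψl l f g)‖ + ‖Ψ (res A Ψ₀ Ψl l f g)‖) ≤ ‖f‖ + ‖g‖ := by
  have hA := smul_res_sub hi hii hl f g
  have hΨ₀u : L1.integral (Ψ₀ (res A Ψ₀ Ψl l f g)) ≤ ‖g‖ := by
    rw [res, map_add, map_res₀_eq_zero, zero_add]
    exact hii.integral_map_apply_le hl hg
  have hu := res_nonneg hi hii hl hf hg
  generalize res A Ψ₀ Ψl l f g = u at *
  have hmass := hiii u hu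
  have hAu : A u = l • (u : Lp ℝ 1 m) - f := by
    rw [sub_eq_iff_eq_add.1 hA]
    abel
  rw [← L1.integral_eq_integral, ← L1.integral_eq_integral, L1.integral_add, L1.integral_sub, hAu,
    L1.integral_sub, L1.integral_smul, ← L1.norm_eq_integral_of_nonneg hu,
    ← L1.norm_eq_integral_of_nonneg hf, ← L1.norm_eq_integral_of_nonneg (hB u hu),
    ← L1.norm_eq_integral_of_nonneg (hΨ u hu), smul_eq_mul] at hmass
  linarith

end Res

/-- The operator `(f, g) ↦ R(l, A₀) f + Ψ(l) g`. -/
noncomputable def resProd (A : D →ₗ[ℝ] Lp ℝ 1 m) (Ψ₀ : D →ₗ[ℝ] Lp ℝ 1 n) (Ψl : ℝ → Lp ℝ 1 n →ₗ[ℝ] D) (l : ℝ) :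
    Lp ℝ 1 m × Lp ℝ 1 n →ₗ[ℝ] D :=
  (res₀ A Ψ₀ l).coprod (Ψl l)

/-- The operator `(f, g) ↦ (B u, Ψ u)`, `u = R(l, A₀) f + Ψ(l) g`, on `L¹ × L¹_∂`. -/
noncomputable def approxK (A B : D →ₗ[ℝ] Lp ℝ 1 m) (Ψ₀ Ψ : D →ₗ[ℝ] Lp ℝ 1 n)
    (Ψl : ℝ → Lp ℝ 1 n →ₗ[ℝ] D) (l : ℝ) : Module.End ℝ (Lp ℝ 1 m × Lp ℝ 1 n) :=
  (B.prod Ψ).comp (resProd A Ψ₀ Ψl l)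

/-- Moves the iteration from `D` to the product space, where the mass balance controls norms. -/
theorem stepOp_pow_resProd (k : ℕ) (w : Lp ℝ 1 m × Lp ℝ 1 n) :
    (stepOp A B Ψ₀ Ψ Ψl l ^ k) (resProd A Ψ₀ Ψl l w) =
      resProd A Ψ₀ Ψl l ((approxK A B Ψ₀ Ψ Ψl l ^ k) w) := by
  induction k with
  | zero => rfl
  | succ k ih => rw [pow_succ', pow_succ', Module.End.mul_apply, ih]; rfl

/-! ### The series for the perturbed resolvent. -/

section Iterates

variable (hi : ∃ S : ℝ → Lp ℝ 1 m →L[ℝ] Lp ℝ 1 m,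
      IsSubstochasticSemigroup S ∧ generator S = kerRestrict A Ψ₀)
  (hii : IsRightInverseFamily A Ψ₀ Ψl) (hB : PositiveOn B) (hΨ : PositiveOn Ψ)
  (hiii : ∀ f : D, 0 ≤ (f : Lp ℝ 1 m) →
      (∫ x, (A f + B f) x ∂m) + (∫ y, (Ψ f - Ψ₀ f) y ∂n) ≤ 0)
include hi hii hB hΨ

theorem approxK_pow_nonneg (hl : 0 < l) {w : Lp ℝ 1 m × Lp ℝ 1 n} (hw : 0 ≤ w) (k : ℕ) :
    0 ≤ (approxK A B Ψ₀ Ψ Ψl l ^ k) w := by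
  induction k with
  | zero => exact hw
  | succ k ih =>
    have hu := res_nonneg hi hii hl ih.1 ih.2
    rw [pow_succ', Module.End.mul_apply]
    exact ⟨hB _ hu, hΨ _ hu⟩

include hiii

/-- Each term is at most the mass lost in one step of `approxK`, so the sum telescopes. -/
theorem sum_norm_stepOp_pow_resProd_le (hl : 0 < l) {w : Lp ℝ 1 m × Lp ℝ 1 n} (hw : 0 ≤ w)
    (N : ℕ) :
    ∑ k ∈ Finset.range N, l * ‖((stepOp A B Ψ₀ Ψ Ψl l ^ k) (resProd A Ψ₀ Ψl l w) : Lp ℝ 1 m)‖ ≤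
      ‖w.1‖ + ‖w.2‖ := by
  set κ : ℕ → Lp ℝ 1 m × Lp ℝ 1 n := fun k => (approxK A B Ψ₀ Ψ Ψl l ^ k) w with hκ
  have hstep : ∀ k, l * ‖((stepOp A B Ψ₀ Ψ Ψl l ^ k) (resProd A Ψ₀ Ψl l w) : Lp ℝ 1 m)‖ ≤
      (‖(κ k).1‖ + ‖(κ k).2‖) - (‖(κ (k + 1)).1‖ + ‖(κ (k + 1)).2‖) := by
    intro k
    have hk := approxK_pow_nonneg hi hii hB hΨ hl hw k
    have := norm_res_add_le hi hii hB hΨ hiii hl hk.1 hk.2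
    rw [stepOp_pow_resProd, hκ]
    simp only [pow_succ', Module.End.mul_apply]
    exact le_sub_iff_add_le.2 this
  calc _ ≤ ∑ k ∈ Finset.range N,
        ((‖(κ k).1‖ + ‖(κ k).2‖) - (‖(κ (k + 1)).1‖ + ‖(κ (k + 1)).2‖)) :=
        Finset.sum_le_sum fun k _ => hstep k
    _ = (‖(κ 0).1‖ + ‖(κ 0).2‖) - (‖(κ N).1‖ + ‖(κ N).2‖) :=
        Finset.sum_range_sub' (fun k => ‖(κ k).1‖ + ‖(κ k).2‖) N
    _ ≤ ‖(κ 0).1‖ + ‖(κ 0).2‖ := sub_le_self _ (by positivity)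

theorem tendsto_stepOp_pow_resProd (hl : 0 < l) {w : Lp ℝ 1 m × Lp ℝ 1 n} (hw : 0 ≤ w) :
    Tendsto (fun k => ((stepOp A B Ψ₀ Ψ Ψl l ^ k) (resProd A Ψ₀ Ψl l w) : Lp ℝ 1 m)) atTop
      (𝓝 0) := by
  have hsum := summable_of_sum_range_le (fun k => by positivity)
    (sum_norm_stepOp_pow_resProd_le hi hii hB hΨ hiii hl hw)
  have := hsum.tendsto_atTop_zero.const_mul l⁻¹
  simp only [inv_mul_cancel_left₀ hl.ne', mul_zero] at this
  exact tendsto_zero_iff_norm_tendsto_zero.2 this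

/-- If `u = R(l', A₀) f + Ψ(l') g` and `(B u, Ψ u) ≤ (f, g)`, then `(l - l') R(l, G) u` differs from
`u` by at most a multiple of the defect `(f, g) - (B u, Ψ u)`. -/
theorem norm_sub_smul_resolventOp_le {P : ℝ → Lp ℝ 1 m →L[ℝ] Lp ℝ 1 m}
    (hP : IsPerturbedSemigroup A B Ψ₀ Ψ Ψl P) {l' : ℝ} (hl : 0 < l) (hl' : 0 < l')
    {f : Lp ℝ 1 m} {g : Lp ℝ 1 n} (hf : 0 ≤ f) (hg : 0 ≤ g)
    (hfB : B (res A Ψ₀ Ψl l' f g) ≤ f) (hgΨ : Ψ (res A Ψ₀ Ψl l' f g) ≤ g) :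
    l * ‖(res A Ψ₀ Ψl l' f g : Lp ℝ 1 m) -
        (l - l') • (resolventOp (generator P) l (res A Ψ₀ Ψl l' f g : Lp ℝ 1 m) : Lp ℝ 1 m)‖ ≤
      ‖f - B (res A Ψ₀ Ψl l' f g)‖ + ‖g - Ψ (res A Ψ₀ Ψl l' f g)‖ := by
  have hid := sub_smul_res₀_res hi hii hl hl' f g
  have hu := res_nonneg hi hii hl' hf hg
  set u := res A Ψ₀ Ψl l' f g
  set T := stepOp A B Ψ₀ Ψ Ψl l
  set w : Lp ℝ 1 m × Lp ℝ 1 n := (B u, Ψ u)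
  have hw : 0 ≤ w := ⟨hB u hu, hΨ u hu⟩
  set r : Lp ℝ 1 m × Lp ℝ 1 n := (f - B u, g - Ψ u)
  have hr : 0 ≤ r := ⟨sub_nonneg.2 hfB, sub_nonneg.2 hgΨ⟩
  have hres : res A Ψ₀ Ψl l f g = T u + resProd A Ψ₀ Ψl l r := by
    change resProd A Ψ₀ Ψl l (f, g) = resProd A Ψ₀ Ψl l w + resProd A Ψ₀ Ψl l r
    rw [← map_add]
    simp [w, r]
  -- The last telescoping term is T^(N+1) u, written as T^N applied to T u = `resProd` w: decay is
  -- known only on the range of `resProd` on nonnegative pairs.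
  have hsum : ∀ N : ℕ, (l - l') • ∑ k ∈ Finset.range (N + 1), (T ^ k) (res₀ A Ψ₀ l u) =
      u - (T ^ N) (resProd A Ψ₀ Ψl l w) -
        ∑ k ∈ Finset.range (N + 1), (T ^ k) (resProd A Ψ₀ Ψl l r) := by
    intro N
    have hstep : ∀ k, (l - l') • (T ^ k) (res₀ A Ψ₀ l u) =
        ((T ^ k) u - (T ^ (k + 1)) u) - (T ^ k) (resProd A Ψ₀ Ψl l r) := by
      intro k
      rw [← map_smul, hid, hres, map_sub, map_add, pow_succ, Module.End.mul_apply]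
      abel
    rw [Finset.smul_sum, Finset.sum_congr rfl fun k _ => hstep k, Finset.sum_sub_distrib,
      Finset.sum_range_sub' (fun k => (T ^ k) u), pow_succ T N]
    rfl
  have hlim := ((hP.resolvent l hl (u : Lp ℝ 1 m)).const_smul (l - l'))
  have hbound : ∀ N : ℕ, l * ‖(u : Lp ℝ 1 m) - (l - l') • ∑ k ∈ Finset.range (N + 1),
      (((T ^ k) (res₀ A Ψ₀ l u) : D) : Lp ℝ 1 m) -
        ((T ^ N) (resProd A Ψ₀ Ψl l w) : Lp ℝ 1 m)‖ ≤ ‖r.1‖ + ‖r.2‖ := by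
    intro N
    have h := congrArg Subtype.val (hsum N)
    simp only [Submodule.coe_smul, Submodule.coe_sub, AddSubmonoidClass.coe_finsetSum] at h
    rw [h, sub_sub, sub_add_eq_add_sub, sub_add_cancel, sub_sub_cancel]
    refine le_trans ?_ (sum_norm_stepOp_pow_resProd_le hi hii hB hΨ hiii hl hr (N + 1))
    rw [← Finset.mul_sum]
    exact mul_le_mul_of_nonneg_left (norm_sum_le _ _) hl.le
  have hlim' := ((tendsto_const_nhds (x := (u : Lp ℝ 1 m))).sub hlim).sub
    (tendsto_stepOp_pow_resProd hi hii hB hΨ hiii hl hw)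
  rw [sub_zero] at hlim'
  exact le_of_tendsto (hlim'.norm.const_mul l) (Eventually.of_forall hbound)

end Iterates

/-! ### Passage to the limit l ↓ 0. -/

section InvariantDensity

variable (hi : ∃ S : ℝ → Lp ℝ 1 m →L[ℝ] Lp ℝ 1 m,
      IsSubstochasticSemigroup S ∧ generator S = kerRestrict A Ψ₀)
  (hii : IsRightInverseFamily A Ψ₀ Ψl) {f : Lp ℝ 1 m} {g : Lp ℝ 1 n}
include hi hii

/-- As l decreases, (B u_l, Ψ u_l) increases, and its limit is (f, g). -/
theorem IsInvariantDensityK.map_res_le (hf : IsInvariantDensityK A B Ψ₀ Ψ Ψl f g)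
    (hB : PositiveOn B) (hΨ : PositiveOn Ψ) (hl : 0 < l) :
    B (res A Ψ₀ Ψl l f g) ≤ f ∧ Ψ (res A Ψ₀ Ψl l f g) ≤ g := by
  refine ge_of_tendsto hf.invariant (b := (B (res A Ψ₀ Ψl l f g), Ψ (res A Ψ₀ Ψl l f g))) ?_
  filter_upwards [self_mem_nhdsWithin, mem_nhdsWithin_of_mem_nhds (Iio_mem_nhds hl)] with l' h0 hl'
  have h := sub_nonneg.2
    (res_antitone hi hii h0 (le_of_lt hl') hf.nonneg_fst hf.nonneg_snd)
  rw [← Submodule.coe_sub] at h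
  constructor
  · simpa using hB _ h
  · simpa using hΨ _ h

theorem tendsto_res_of_isLUB (hf : 0 ≤ f) (hg : 0 ≤ g) {fbar : Lp ℝ 1 m}
    (hfbar : IsLUB {u : Lp ℝ 1 m | ∃ l : ℝ, 0 < l ∧ u = (res A Ψ₀ Ψl l f g : Lp ℝ 1 m)} fbar) :
    Tendsto (fun k : ℕ => (res A Ψ₀ Ψl (1 / ((k : ℝ) + 1)) f g : Lp ℝ 1 m)) atTop (𝓝 fbar) := by
  have hmono : Monotone fun k : ℕ => (res A Ψ₀ Ψl (1 / ((k : ℝ) + 1)) f g : Lp ℝ 1 m) :=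
    fun i j hij => res_antitone hi hii Nat.one_div_pos_of_nat (Nat.one_div_le_one_div hij) hf hg
  have hle : ∀ k : ℕ, (res A Ψ₀ Ψl (1 / ((k : ℝ) + 1)) f g : Lp ℝ 1 m) ≤ fbar :=
    fun k => hfbar.1 ⟨_, Nat.one_div_pos_of_nat, rfl⟩
  obtain ⟨v, hv⟩ := L1.exists_tendsto_of_monotone hmono hle
  have hvf : v ≤ fbar := le_of_tendsto hv (Eventually.of_forall hle)
  have hfv : fbar ≤ v := by
    refine hfbar.2 ?_
    rintro _ ⟨l, hl, rfl⟩
    obtain ⟨k, hk⟩ := exists_nat_one_div_lt hl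
    exact (res_antitone hi hii Nat.one_div_pos_of_nat hk.le hf hg).trans
      (hmono.ge_of_tendsto hv k)
  rwa [← le_antisymm hvf hfv]

end InvariantDensity

end BoundaryPerturbation

end Perturbation

theorem theorem3p9 {E F : Type*} [MeasurableSpace E] [MeasurableSpace F]
    (m : MeasureTheory.Measure E) [MeasureTheory.SigmaFinite m]
    (n : MeasureTheory.Measure F) [MeasureTheory.SigmaFinite n]
    (D : Submodule ℝ (Lp ℝ 1 m))
    (A B : D →ₗ[ℝ] Lp ℝ 1 m) (Ψ₀ Ψ : D →ₗ[ℝ] Lp ℝ 1 n)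
    (hB : BoundaryPerturbation.PositiveOn B)
    (hΨ₀ : BoundaryPerturbation.PositiveOn Ψ₀)
    (hΨ : BoundaryPerturbation.PositiveOn Ψ)
    (hi : ∃ S : ℝ → Lp ℝ 1 m →L[ℝ] Lp ℝ 1 m,
      BoundaryPerturbation.IsSubstochasticSemigroup S ∧
      BoundaryPerturbation.generator S = BoundaryPerturbation.kerRestrict A Ψ₀)
    (Ψl : ℝ → Lp ℝ 1 n →ₗ[ℝ] D)
    (hii : BoundaryPerturbation.IsRightInverseFamily A Ψ₀ Ψl)
    (hiii : ∀ f : D, 0 ≤ (f : Lp ℝ 1 m) →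
      (∫ x, (A f + B f) x ∂m) + (∫ y, (Ψ f - Ψ₀ f) y ∂n) ≤ 0)
    (P : ℝ → Lp ℝ 1 m →L[ℝ] Lp ℝ 1 m)
    (hP : BoundaryPerturbation.IsPerturbedSemigroup A B Ψ₀ Ψ Ψl P)
    (f : Lp ℝ 1 m) (f_bd : Lp ℝ 1 n)
    (hf : BoundaryPerturbation.IsInvariantDensityK A B Ψ₀ Ψ Ψl f f_bd)
    (fbar : Lp ℝ 1 m)
    (hfbar : IsLUB {u : Lp ℝ 1 m | ∃ l : ℝ, 0 < l ∧
      u = (BoundaryPerturbation.res A Ψ₀ Ψl l f f_bd : Lp ℝ 1 m)} fbar) :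
    BoundaryPerturbation.IsInvariantDensity P (‖fbar‖⁻¹ • fbar) := by
  have hu : Tendsto (fun k : ℕ => (res A Ψ₀ Ψl (1 / ((k : ℝ) + 1)) f f_bd : Lp ℝ 1 m)) atTop
      (𝓝 fbar) := tendsto_res_of_isLUB hi hii hf.nonneg_fst hf.nonneg_snd hfbar
  have hl : Tendsto (fun k : ℕ => 1 / ((k : ℝ) + 1)) atTop (𝓝 0) :=
    tendsto_one_div_add_atTop_nhds_zero_nat
  have hK := hf.invariant.comp (tendsto_nhdsWithin_iff.2
    ⟨hl, Eventually.of_forall fun k => Set.mem_Ioi.2 Nat.one_div_pos_of_nat⟩)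
  have hnonneg : 0 ≤ fbar := (res_nonneg hi hii one_pos hf.nonneg_fst hf.nonneg_snd).trans
    (hfbar.1 ⟨1, one_pos, rfl⟩)
  -- If f̄ = 0, then u_l = 0 along the sequence, so K(f, f_∂) = 0, against norm 1.
  have hne : fbar ≠ 0 := by
    rintro rfl
    have hzero : ∀ k : ℕ, res A Ψ₀ Ψl (1 / ((k : ℝ) + 1)) f f_bd = 0 := fun k =>
      Subtype.ext (le_antisymm (hfbar.1 ⟨_, Nat.one_div_pos_of_nat, rfl⟩)
        (res_nonneg hi hii Nat.one_div_pos_of_nat hf.nonneg_fst hf.nonneg_snd))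
    have h : ((0 : Lp ℝ 1 m), (0 : Lp ℝ 1 n)) = (f, f_bd) := by
      refine tendsto_nhds_unique (tendsto_const_nhds.congr fun k : ℕ => ?_) hK
      simp only [Function.comp_apply, hzero, map_zero]
    have hnorm := hf.norm_eq_one
    obtain ⟨h₁, h₂⟩ := Prod.mk.inj h
    simp [← h₁, ← h₂] at hnorm
  -- The defect estimate with l = 1 and l' = 1/(k+1), in the limit k → ∞.
  have hG : (1 : ℝ) • (resolventOp (generator P) 1 fbar : Lp ℝ 1 m) = fbar := by
    have hR := ((continuous_resolventOp (hP.semigroup.mem_resolventSet one_pos)).tendsto fbar).comp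
      hu
    have hdiff := (hu.sub ((tendsto_const_nhds (x := (1 : ℝ)).sub hl).smul hR)).norm.const_mul
      (1 : ℝ)
    have hdefect := ((tendsto_const_nhds (x := f)).sub hK.fst_nhds).norm.add
      ((tendsto_const_nhds (x := f_bd)).sub hK.snd_nhds).norm
    have hle := le_of_tendsto_of_tendsto' hdiff hdefect fun k =>
      have hk := hf.map_res_le hi hii hB hΨ (Nat.one_div_pos_of_nat (n := k))
      norm_sub_smul_resolventOp_le hi hii hB hΨ hiii hP one_pos Nat.one_div_pos_of_nat
        hf.nonneg_fst hf.nonneg_snd hk.1 hk.2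
    simp only [sub_self, norm_zero, add_zero, sub_zero, one_mul] at hle
    exact (sub_eq_zero.1 (norm_le_zero_iff.1 hle)).symm
  refine ⟨smul_nonneg (inv_nonneg.2 (norm_nonneg _)) hnonneg, ?_, fun t ht => ?_⟩
  · rw [norm_smul, norm_inv, norm_norm, inv_mul_cancel₀ (norm_ne_zero_iff.2 hne)]
  · rw [map_smul, hP.semigroup.invariant_of_smul_resolventOp_eq one_pos hG ht.le]
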